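/- Let $n \ge 2$ and let $B(0,1)$ be the open unit ball of $\mathbf{R}^n$. There exists a continuous matrix field $A \in C(B(0,1); \mathbf{R}^{n\times n})$ which is elliptic, that is, $A(x)$ is symmetric for every $x \in B(0,1)$ and there are constants $\lambda, \Lambda > 0$ such that $$\lambda |\xi|^2 \le (A(x)\xi)\cdot \xi \le \Lambda |\xi|^2 \qquad \text{for all } x \in B(0,1),\ \xi \in \mathbf{R}^n,$$ such that the Dirichlet problem $$-\operatorname{div}(A\nabla u) = 0 \ \text{ in } B(0,1), \qquad u = 0 \ \text{ on } \partial B(0,1),$$ has a nontrivial weak solution in $W^{1,1}$: there is a function $u \in W^{1,1}_0(B(0,1))$ (the closure of $C_c^\infty(B(0,1))$ in $W^{1,1}(B(0,1))$) which is not equal to $0$ almost everywhere in $B(0,1)$ and satisfies $$\int_{B(0,1)} (A\nabla u)\cdot\nabla\varphi = 0 \qquad \text{for every } \varphi \in C^1_c(B(0,1)).$$ -/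

import Mathlib

open MeasureTheory Set Filter Topology
open scoped Gradient Matrix

/-- `φ` belongs to `C^k_c(Ω)`: it is of class `C^k` and its support is a compact subset
of `Ω`. -/
def IsTestFunction {n : ℕ} (Ω : Set (EuclideanSpace ℝ (Fin n))) (k : ℕ∞)
    (φ : EuclideanSpace ℝ (Fin n) → ℝ) : Prop :=
  ContDiff ℝ k φ ∧ HasCompactSupport φ ∧ tsupport φ ⊆ Ω

/-- `u` and `G` are locally integrable on the open set `Ω` and `G` is the gradient of `u` in the
sense of distributions on `Ω`. So `u ∈ W^{1,1}_loc(Ω)` means that such a `G` exists; it is then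
unique almost everywhere on `Ω`. -/
structure HasWeakGradient {n : ℕ} (Ω : Set (EuclideanSpace ℝ (Fin n)))
    (u : EuclideanSpace ℝ (Fin n) → ℝ)
    (G : EuclideanSpace ℝ (Fin n) → EuclideanSpace ℝ (Fin n)) : Prop where
  locallyIntegrableOn : LocallyIntegrableOn u Ω
  locallyIntegrableOn_grad : LocallyIntegrableOn G Ω
  integral_eq : ∀ φ : EuclideanSpace ℝ (Fin n) → ℝ, IsTestFunction Ω ⊤ φ →
    ∀ i : Fin n, ∫ x in Ω, u x * (∇ φ x) i = -∫ x in Ω, (G x) i * φ x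

/-- `u ∈ W^{1,1}_0(Ω)`: `u ∈ W^{1,1}(Ω)` is a limit of functions of class `C^∞_c(Ω)` in the
norm `‖u‖_{L¹(Ω)} + ‖∇u‖_{L¹(Ω)}`. -/
def MemW11Zero {n : ℕ} (Ω : Set (EuclideanSpace ℝ (Fin n)))
    (u : EuclideanSpace ℝ (Fin n) → ℝ) : Prop :=
  ∃ G : EuclideanSpace ℝ (Fin n) → EuclideanSpace ℝ (Fin n),
    HasWeakGradient Ω u G ∧ IntegrableOn u Ω ∧ IntegrableOn G Ω ∧
    ∃ φ : ℕ → EuclideanSpace ℝ (Fin n) → ℝ, (∀ k, IsTestFunction Ω ⊤ (φ k)) ∧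
      Tendsto (fun k => ∫ x in Ω, |φ k x - u x|) atTop (𝓝 0) ∧
      Tendsto (fun k => ∫ x in Ω, ‖∇ (φ k) x - G x‖) atTop (𝓝 0)

/-- The matrix field `A` is elliptic on `Ω`: it is symmetric, bounded and uniformly positive
definite there. -/
def IsElliptic {n : ℕ} (Ω : Set (EuclideanSpace ℝ (Fin n)))
    (A : EuclideanSpace ℝ (Fin n) → Matrix (Fin n) (Fin n) ℝ) : Prop :=
  ∃ l L : ℝ, 0 < l ∧ 0 < L ∧ ∀ x ∈ Ω, (A x).IsSymm ∧ ∀ ξ : EuclideanSpace ℝ (Fin n),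
    l * ‖ξ‖ ^ 2 ≤ (A x *ᵥ ξ.ofLp) ⬝ᵥ ξ.ofLp ∧ (A x *ᵥ ξ.ofLp) ⬝ᵥ ξ.ofLp ≤ L * ‖ξ‖ ^ 2

/-- `u ∈ W^{1,1}_loc(Ω)` is a weak solution of `-div (A ∇u) = 0` in `Ω`. -/
def IsWeakSolution {n : ℕ} (Ω : Set (EuclideanSpace ℝ (Fin n)))
    (A : EuclideanSpace ℝ (Fin n) → Matrix (Fin n) (Fin n) ℝ)
    (u : EuclideanSpace ℝ (Fin n) → ℝ) : Prop :=
  ∃ G : EuclideanSpace ℝ (Fin n) → EuclideanSpace ℝ (Fin n), HasWeakGradient Ω u G ∧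
    ∀ φ : EuclideanSpace ℝ (Fin n) → ℝ, IsTestFunction Ω 1 φ →
      ∫ x in Ω, (A x *ᵥ (G x).ofLp) ⬝ᵥ (∇ φ x).ofLp = 0

/-!
Look for a solution of dipole type, `u x = ⟪e, x⟫ * κ (log ‖x‖)`, in a medium whose conductivity is
`1` in the radial direction and `1 + α (log ‖x‖)` in the tangential directions. Away from the origin
the equation says `(n - 1) * α * κ = κ'' + n * κ'`, which for `α = 0` is solved by the constants and
by the singular profile `‖x‖ ^ (-n)`. Given a profile one can instead solve for `α`. Dividing the
harmonic profile `‖x‖ ^ (-n) - 1` by `64 + (log ‖x‖) ^ 2` makes `∇u` just integrable and still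
forces `α → 0` at the origin, so that the coefficients are continuous there.

The flux `A ∇u` has no mass at the origin because it is even: only the odd part of a test function
contributes to the weak formulation, and the odd part vanishes at the origin, which compensates the
gradient of a cutoff there.
-/

open scoped RealInnerProductSpace

lemma contDiff_of_forall_mem_tsupport {E F : Type*} [NormedAddCommGroup E] [NormedSpace ℝ E]
    [NormedAddCommGroup F] [NormedSpace ℝ F] {m : WithTop ℕ∞} {f : E → F}
    (hf : ∀ x ∈ tsupport f, ContDiffAt ℝ m f x) : ContDiff ℝ m f :=
  contDiff_iff_contDiffAt.2 fun x => by
    by_cases hx : x ∈ tsupport f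
    · exact hf x hx
    · exact contDiffAt_const.congr_of_eventuallyEq (notMem_tsupport_iff_eventuallyEq.1 hx)

section Gradient

variable {F : Type*} [NormedAddCommGroup F] [InnerProductSpace ℝ F] [CompleteSpace F]
  {f g : F → ℝ} {f' g' x : F}

lemma hasGradientAt_mul (hf : HasGradientAt f f' x) (hg : HasGradientAt g g' x) :
    HasGradientAt (fun y => f y * g y) (f x • g' + g x • f') x := by
  rw [hasGradientAt_iff_hasFDerivAt]
  exact (hf.hasFDerivAt.mul hg.hasFDerivAt).congr_fderiv (by simp)

lemma hasGradientAt_comp {h : ℝ → ℝ} {h' : ℝ} (hh : HasDerivAt h h' (f x))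
    (hf : HasGradientAt f f' x) : HasGradientAt (fun y => h (f y)) (h' • f') x := by
  rw [hasGradientAt_iff_hasFDerivAt]
  exact (hh.comp_hasFDerivAt x hf.hasFDerivAt).congr_fderiv (by simp)

lemma hasGradientAt_inner_left (e x : F) : HasGradientAt (fun y => ⟪e, y⟫) e x :=
  hasGradientAt_iff_hasFDerivAt.2 (InnerProductSpace.toDual ℝ F e).hasFDerivAt

lemma hasGradientAt_norm_sq (x : F) : HasGradientAt (fun y => ‖y‖ ^ 2) ((2 : ℝ) • x) x := by
  rw [hasGradientAt_iff_hasFDerivAt]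
  refine (hasStrictFDerivAt_norm_sq x).hasFDerivAt.congr_fderiv ?_
  ext y
  simp

lemma hasGradientAt_log_norm (hx : x ≠ 0) :
    HasGradientAt (fun y => Real.log ‖y‖) ((‖x‖ ^ 2)⁻¹ • x) x := by
  have hx2 : ‖x‖ ^ 2 ≠ 0 := by simpa using hx
  have h := hasGradientAt_comp (f := fun y : F => ‖y‖ ^ 2)
    ((Real.hasDerivAt_log hx2).const_mul 2⁻¹) (hasGradientAt_norm_sq x)
  convert h using 1
  · ext y
    simp [Real.log_pow]
  · rw [smul_smul, mul_right_comm, inv_mul_cancel₀ two_ne_zero, one_mul]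

lemma gradient_fun_sub (hf : DifferentiableAt ℝ f x) (hg : DifferentiableAt ℝ g x) :
    ∇ (fun y => f y - g y) x = ∇ f x - ∇ g x := by
  rw [gradient, fderiv_fun_sub hf hg, map_sub, gradient, gradient]

lemma continuous_gradient (hf : ContDiff ℝ 1 f) : Continuous (∇ f) :=
  (InnerProductSpace.toDual ℝ F).symm.continuous.comp (hf.continuous_fderiv one_ne_zero)

lemma tsupport_gradient_subset (f : F → ℝ) : tsupport (∇ f) ⊆ tsupport f := by
  refine (closure_mono fun x hx => ?_).trans (tsupport_fderiv_subset ℝ)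
  contrapose! hx
  simp only [Function.mem_support, not_not] at hx ⊢
  simp [gradient, hx]

lemma gradient_comp_neg (f : F → ℝ) (x : F) : ∇ (fun y => f (-y)) x = -∇ f (-x) := by
  rw [gradient, gradient, show (fun y => f (-y)) = f ∘ ContinuousLinearEquiv.neg ℝ from rfl,
    ContinuousLinearEquiv.comp_right_fderiv, ← map_neg]
  congr 1
  ext y
  simp

end Gradient

section Divergence

variable {E : Type*} [NormedAddCommGroup E] [InnerProductSpace ℝ E]

/-- The divergence of a vector field, as the trace of its derivative, so that no basis has to be
chosen. -/
noncomputable def divergence (V : E → E) (x : E) : ℝ := LinearMap.trace ℝ E (fderiv ℝ V x)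

lemma divergence_add {V W : E → E} {x : E} (hV : DifferentiableAt ℝ V x)
    (hW : DifferentiableAt ℝ W x) :
    divergence (fun y => V y + W y) x = divergence V x + divergence W x := by
  rw [divergence, fderiv_fun_add hV hW, ContinuousLinearMap.toLinearMap_add, map_add, divergence,
    divergence]

variable [FiniteDimensional ℝ E]

lemma divergence_id (x : E) : divergence id x = Module.finrank ℝ E := by
  simp [divergence]

lemma divergence_smul {g : E → ℝ} {V : E → E} {x : E} (hg : DifferentiableAt ℝ g x)
    (hV : DifferentiableAt ℝ V x) :
    divergence (fun y => g y • V y) x = g x * divergence V x + ⟪V x, ∇ g x⟫ := by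
  rw [divergence, fderiv_fun_smul hg hV, real_inner_comm, inner_gradient_left]
  simp [divergence]

lemma integral_divergence_eq_zero [MeasurableSpace E] [BorelSpace E] {μ : Measure E}
    [μ.IsAddHaarMeasure] {W : E → E} (hW : ContDiff ℝ 1 W) (hWc : HasCompactSupport W) :
    ∫ x, divergence W x ∂μ = 0 := by
  have hi : ∀ v, Integrable (fun x => fderiv ℝ W x v) μ := fun v =>
    ((hW.continuous_fderiv one_ne_zero).clm_apply continuous_const).integrable_of_hasCompactSupport
      (hWc.fderiv_apply ℝ v)
  have hz : ∀ v, ∫ x, fderiv ℝ W x v ∂μ = 0 := fun v => by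
    have h := integral_bilinear_fderiv_right_eq_neg_left_of_integrable
      (B := ContinuousLinearMap.lsmul ℝ ℝ) (f := fun _ : E => (1 : ℝ)) (g := W) (v := v) (μ := μ)
      (by simp) (by simpa using hi v)
      (by simpa using hW.continuous.integrable_of_hasCompactSupport hWc)
      (by simp) (fun x _ => hW.differentiable one_ne_zero x)
    simpa using h
  let b := stdOrthonormalBasis ℝ E
  simp only [divergence, LinearMap.trace_eq_sum_inner _ b, ContinuousLinearMap.coe_coe]
  rw [integral_finsetSum _ fun i _ => (hi (b i)).const_inner (b i)]
  refine Finset.sum_eq_zero fun i _ => ?_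
  rw [integral_inner (hi (b i)), hz, inner_zero_right]

lemma integral_inner_gradient_eq_zero [MeasurableSpace E] [BorelSpace E] {μ : Measure E}
    [μ.IsAddHaarMeasure] {g : E → ℝ} {V : E → E} (hg : ContDiff ℝ 1 g) (hgc : HasCompactSupport g)
    (hV : ∀ x ∈ tsupport g, ContDiffAt ℝ 1 V x) (hdiv : ∀ x ∈ tsupport g, divergence V x = 0) :
    ∫ x, ⟪V x, ∇ g x⟫ ∂μ = 0 := by
  have hgV : ContDiff ℝ 1 fun x => g x • V x := contDiff_of_forall_mem_tsupport fun x hx =>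
    hg.contDiffAt.smul (hV x (tsupport_smul_subset_left g V hx))
  rw [← integral_divergence_eq_zero (μ := μ) hgV hgc.smul_right]
  refine integral_congr_ae (.of_forall fun x => ?_)
  by_cases hx : x ∈ tsupport g
  · simp only [divergence_smul (hg.differentiable one_ne_zero x)
      ((hV x hx).differentiableAt one_ne_zero), hdiv x hx, mul_zero, zero_add]
  · have h0 : (fun y => g y • V y) =ᶠ[𝓝 x] 0 := by
      filter_upwards [notMem_tsupport_iff_eventuallyEq.1 hx] with y hy
      simp [hy]
    simp [divergence, h0.fderiv_eq,
      image_eq_zero_of_notMem_tsupport fun h => hx (tsupport_gradient_subset g h)]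

end Divergence

section Cutoff

/-- The cutoff function along `ρ`: it vanishes where `(k + 1) ρ ≤ 1` and equals `1` where
`2 ≤ (k + 1) ρ`, so it exhausts `{0 < ρ}` as `k → ∞`. -/
noncomputable def cutoff {X : Type*} (ρ : X → ℝ) (k : ℕ) (x : X) : ℝ :=
  Real.smoothTransition ((k + 1) * ρ x - 1)

lemma norm_cutoff_smul_le {X V : Type*} [NormedAddCommGroup V] [NormedSpace ℝ V] (ρ : X → ℝ)
    (k : ℕ) (x : X) (v : V) : ‖cutoff ρ k x • v‖ ≤ ‖v‖ := by
  rw [cutoff, norm_smul, Real.norm_of_nonneg (Real.smoothTransition.nonneg _)]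
  exact mul_le_of_le_one_left (norm_nonneg _) (Real.smoothTransition.le_one _)

section Topological

variable {X : Type*} [TopologicalSpace X] {ρ : X → ℝ}

lemma tsupport_cutoff_subset (hρ : Continuous ρ) (k : ℕ) :
    tsupport (cutoff ρ k) ⊆ {x | 0 < ρ x} := by
  have hsub : tsupport (cutoff ρ k) ⊆ {x | 1 ≤ (k + 1) * ρ x} := by
    refine closure_minimal (fun x hx => ?_) (isClosed_le continuous_const (by fun_prop))
    by_contra hlt
    rw [mem_ofPred_eq, not_le] at hlt
    exact hx (Real.smoothTransition.zero_of_nonpos (by linarith))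
  exact fun x hx => show 0 < ρ x from
    pos_of_mul_pos_right (one_pos.trans_le (hsub hx)) k.cast_add_one_pos.le

lemma eventually_cutoff_mul_eventuallyEq {x : X} (hρ : ContinuousAt ρ x) (hx : 0 < ρ x)
    (f : X → ℝ) : ∀ᶠ k in atTop, (fun y => cutoff ρ k y * f y) =ᶠ[𝓝 x] f := by
  have hlim : Tendsto (fun k : ℕ => ((k : ℝ) + 1) * ρ x) atTop atTop :=
    (tendsto_atTop_add_const_right _ _ tendsto_natCast_atTop_atTop).atTop_mul_const hx
  filter_upwards [hlim.eventually_gt_atTop 2] with k hk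
  filter_upwards [(hρ.const_mul ((k : ℝ) + 1)).eventually (lt_mem_nhds hk)] with y hy
  rw [cutoff, Real.smoothTransition.one_of_one_le (by linarith), one_mul]

end Topological

lemma exists_abs_add_one_mul_deriv_smoothTransition_le :
    ∃ C, ∀ t, |(t + 1) * deriv Real.smoothTransition t| ≤ C := by
  have hcont : Continuous (deriv Real.smoothTransition) :=
    Real.smoothTransition.contDiff.continuous_deriv (n := 1) le_rfl
  have hsupp : HasCompactSupport (deriv Real.smoothTransition) := by
    refine HasCompactSupport.intro (isCompact_Icc (a := 0) (b := 1)) fun t ht => ?_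
    rw [mem_Icc, not_and_or, not_le, not_le] at ht
    rcases ht with ht | ht
    · have h0 : Real.smoothTransition =ᶠ[𝓝 t] fun _ => 0 := by
        filter_upwards [Iio_mem_nhds ht] with s hs
        exact Real.smoothTransition.zero_of_nonpos (le_of_lt hs)
      rw [h0.deriv_eq, deriv_const]
    · have h1 : Real.smoothTransition =ᶠ[𝓝 t] fun _ => 1 := by
        filter_upwards [Ioi_mem_nhds ht] with s hs
        exact Real.smoothTransition.one_of_one_le (le_of_lt hs)
      rw [h1.deriv_eq, deriv_const]
  exact ((continuous_id.add continuous_const).mul hcont).bounded_above_of_compact_support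
    hsupp.mul_left

variable {F : Type*} [NormedAddCommGroup F] [InnerProductSpace ℝ F]

lemma contDiff_cutoff_mul {m : ℕ∞} {ρ f : F → ℝ} (hρ : ContDiff ℝ m ρ)
    (hf : ∀ x, 0 < ρ x → ContDiffAt ℝ m f x) (k : ℕ) :
    ContDiff ℝ m fun x => cutoff ρ k x * f x := by
  have hcutoff : ContDiff ℝ m (cutoff ρ k) :=
    Real.smoothTransition.contDiff.comp ((contDiff_const.mul hρ).sub contDiff_const)
  exact contDiff_of_forall_mem_tsupport fun x hx => hcutoff.contDiffAt.mul
    (hf x (tsupport_cutoff_subset hρ.continuous k (tsupport_mul_subset_left hx)))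

variable [CompleteSpace F]

lemma hasGradientAt_cutoff {ρ : F → ℝ} {x ρ' : F} (hρ : HasGradientAt ρ ρ' x) (k : ℕ) :
    HasGradientAt (cutoff ρ k)
      ((deriv Real.smoothTransition ((k + 1) * ρ x - 1) * (k + 1)) • ρ') x := by
  have hst : HasDerivAt Real.smoothTransition _ ((k + 1) * ρ x - 1) :=
    (Real.smoothTransition.contDiff.differentiable (n := 1) one_ne_zero _).hasDerivAt
  have hlin : HasDerivAt (fun t : ℝ => (k + 1) * t - 1) (k + 1) (ρ x) := by
    simpa using ((hasDerivAt_id (ρ x)).const_mul (k + 1 : ℝ)).sub_const 1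
  exact hasGradientAt_comp (h := fun t => Real.smoothTransition ((k + 1) * t - 1))
    (HasDerivAt.comp (h := fun t => (k + 1) * t - 1) (ρ x) hst hlin) hρ

lemma exists_norm_gradient_cutoff_mul_le :
    ∃ C, ∀ (ρ f : F → ℝ) (ρ' f' x : F) (M : ℝ) (k : ℕ), HasGradientAt ρ ρ' x →
      HasGradientAt f f' x → 0 < ρ x → ‖f'‖ ≤ M → |f x| * ‖ρ'‖ ≤ M * ρ x →
      ‖∇ (fun y => cutoff ρ k y * f y) x‖ ≤ C * M := by
  obtain ⟨C, hC⟩ := exists_abs_add_one_mul_deriv_smoothTransition_le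
  refine ⟨1 + C, fun ρ f ρ' f' x M k hρ hf hx hf' hfρ => ?_⟩
  set t : ℝ := (k + 1) * ρ x - 1 with ht
  have hfirst : ‖cutoff ρ k x • f'‖ ≤ M := (norm_cutoff_smul_le ρ k x f').trans hf'
  have hsecond : ‖f x • (deriv Real.smoothTransition t * (k + 1)) • ρ'‖ ≤ C * M := by
    rw [← mul_le_mul_iff_left₀ hx, norm_smul, norm_smul, Real.norm_eq_abs, Real.norm_eq_abs]
    calc |f x| * (|deriv Real.smoothTransition t * (k + 1)| * ‖ρ'‖) * ρ x
        = |(t + 1) * deriv Real.smoothTransition t| * (|f x| * ‖ρ'‖) := by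
          rw [show (t + 1) * deriv Real.smoothTransition t =
            deriv Real.smoothTransition t * (k + 1) * ρ x by rw [ht]; ring,
            abs_mul _ (ρ x), abs_of_pos hx]
          ring
      _ ≤ C * (M * ρ x) :=
          mul_le_mul (hC t) hfρ (by positivity) ((abs_nonneg _).trans (hC t))
      _ = C * M * ρ x := by ring
  rw [(hasGradientAt_mul (hasGradientAt_cutoff hρ k) hf).gradient]
  linarith [norm_add_le (cutoff ρ k x • f')
    (f x • (deriv Real.smoothTransition t * (k + 1)) • ρ')]

end Cutoff

section DivergenceFree

lemma integrableOn_inner_gradient {F : Type*} [NormedAddCommGroup F] [InnerProductSpace ℝ F]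
    [CompleteSpace F] [MeasurableSpace F] [OpensMeasurableSpace F] [SecondCountableTopology F]
    {μ : Measure F} {Ω : Set F} {V : F → F} (hV : IntegrableOn V Ω μ) {g : F → ℝ}
    (hg : ContDiff ℝ 1 g) (hgc : HasCompactSupport g) :
    IntegrableOn (fun x => ⟪V x, ∇ g x⟫) Ω μ := by
  obtain ⟨C, hC⟩ := (continuous_gradient hg).bounded_above_of_compact_support
    (hgc.of_isClosed_subset (isClosed_tsupport _) (tsupport_gradient_subset g))
  refine (hV.norm.mul_const C).mono'
    (hV.aestronglyMeasurable.inner (continuous_gradient hg).aestronglyMeasurable)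
    (.of_forall fun x => ?_)
  exact (norm_inner_le_norm _ _).trans (mul_le_mul_of_nonneg_left (hC x) (norm_nonneg _))

lemma exists_norm_gradient_cutoff_norm_sq_mul_le {F : Type*} [NormedAddCommGroup F]
    [InnerProductSpace ℝ F] [CompleteSpace F] {g : F → ℝ} (hg : Differentiable ℝ g) {L : NNReal}
    (hL : LipschitzWith L g) (hg0 : g 0 = 0) :
    ∃ C : ℝ, ∀ k, ∀ x ≠ 0, ‖∇ (fun y => cutoff (fun z => ‖z‖ ^ 2) k y * g y) x‖ ≤ C := by
  obtain ⟨C, hC⟩ := exists_norm_gradient_cutoff_mul_le (F := F)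
  refine ⟨C * (2 * L), fun k x hx => ?_⟩
  have hgrad : ‖∇ g x‖ ≤ L := by
    simpa [gradient] using norm_fderiv_le_of_lipschitz ℝ (x₀ := x) hL
  have hgx : |g x| ≤ L * ‖x‖ := by simpa [hg0] using hL.norm_sub_le x 0
  refine hC _ g _ _ x _ k (hasGradientAt_norm_sq x) (hg x).hasGradientAt
    (pow_pos (norm_pos_iff.2 hx) 2) (hgrad.trans (by linarith [L.coe_nonneg])) ?_
  calc |g x| * ‖(2 : ℝ) • x‖ ≤ L * ‖x‖ * ‖(2 : ℝ) • x‖ := by gcongr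
    _ = 2 * L * ‖x‖ ^ 2 := by rw [norm_smul, Real.norm_two]; ring

variable {E : Type*} [NormedAddCommGroup E] [InnerProductSpace ℝ E] [FiniteDimensional ℝ E]
  [MeasurableSpace E] [BorelSpace E] {μ : Measure E} [μ.IsAddHaarMeasure]
  {Ω : Set E} {V : E → E}

/-- The cutoffs `χ_k` around the origin satisfy `‖∇χ_k(x)‖ ≤ C / ‖x‖`, which is compensated by
`|g(x)| ≤ C ‖x‖`; this is where `g 0 = 0` enters. -/
lemma setIntegral_inner_gradient_eq_zero_of_punctured [Nontrivial E] (hVi : IntegrableOn V Ω μ)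
    (hV : ∀ x ∈ Ω, x ≠ 0 → ContDiffAt ℝ 1 V x) (hdiv : ∀ x ∈ Ω, x ≠ 0 → divergence V x = 0)
    {g : E → ℝ} (hg : ContDiff ℝ 1 g) (hgc : HasCompactSupport g) (hgΩ : tsupport g ⊆ Ω)
    (hg0 : g 0 = 0) : ∫ x in Ω, ⟪V x, ∇ g x⟫ ∂μ = 0 := by
  let ρ : E → ℝ := fun x => ‖x‖ ^ 2
  have hρ : ContDiff ℝ 1 ρ := contDiff_norm_sq ℝ
  have hρpos : ∀ {x}, 0 < ρ x ↔ x ≠ 0 := by simp [ρ, sq_pos_iff]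
  let gk : ℕ → E → ℝ := fun k x => cutoff ρ k x * g x
  have hgk : ∀ k, ContDiff ℝ 1 (gk k) :=
    contDiff_cutoff_mul (m := 1) hρ fun x _ => hg.contDiffAt
  have hsupp : ∀ k, ∀ x ∈ tsupport (gk k), x ∈ Ω ∧ x ≠ 0 := fun k x hx =>
    ⟨hgΩ (tsupport_mul_subset_right hx),
      hρpos.1 (tsupport_cutoff_subset hρ.continuous k (tsupport_mul_subset_left hx))⟩
  have hzero : ∀ k, ∫ x in Ω, ⟪V x, ∇ (gk k) x⟫ ∂μ = 0 := fun k => by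
    rw [setIntegral_eq_integral_of_forall_compl_eq_zero fun x hx => ?_]
    · exact integral_inner_gradient_eq_zero (hgk k) hgc.mul_left
        (fun x hx => hV x (hsupp k x hx).1 (hsupp k x hx).2)
        fun x hx => hdiv x (hsupp k x hx).1 (hsupp k x hx).2
    · rw [image_eq_zero_of_notMem_tsupport fun h =>
        hx (hsupp k x (tsupport_gradient_subset _ h)).1, inner_zero_right]
  have hne : ∀ᵐ x ∂μ.restrict Ω, x ≠ 0 := ae_restrict_of_ae (Measure.ae_ne μ 0)
  obtain ⟨L, hL⟩ := hg.lipschitzWith_of_hasCompactSupport hgc one_ne_zero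
  obtain ⟨C, hC⟩ :=
    exists_norm_gradient_cutoff_norm_sq_mul_le (hg.differentiable one_ne_zero) hL hg0
  have hlim : Tendsto (fun k => ∫ x in Ω, ⟪V x, ∇ (gk k) x⟫ ∂μ) atTop
      (𝓝 (∫ x in Ω, ⟪V x, ∇ g x⟫ ∂μ)) :=
    tendsto_integral_of_dominated_convergence (fun x => ‖V x‖ * C)
      (fun k => (integrableOn_inner_gradient hVi (hgk k) hgc.mul_left).aestronglyMeasurable)
      (hVi.norm.mul_const _)
      (fun k => hne.mono fun x hx => (norm_inner_le_norm _ _).trans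
        (mul_le_mul_of_nonneg_left (hC k x hx) (norm_nonneg _)))
      (hne.mono fun x hx => tendsto_const_nhds.congr' <|
        (eventually_cutoff_mul_eventuallyEq hρ.continuous.continuousAt (hρpos.2 hx) g).mono
          fun k hk => congrArg _ hk.gradient_eq.symm)
  simp only [hzero] at hlim
  exact tendsto_nhds_unique hlim tendsto_const_nhds

/-- Only the odd part of `φ` contributes, and it vanishes at the origin. -/
lemma setIntegral_inner_gradient_eq_zero_of_even [Nontrivial E] (hΩ : -Ω = Ω)
    (hVi : IntegrableOn V Ω μ) (hVeven : ∀ x, V (-x) = V x)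
    (hV : ∀ x ∈ Ω, x ≠ 0 → ContDiffAt ℝ 1 V x) (hdiv : ∀ x ∈ Ω, x ≠ 0 → divergence V x = 0)
    {φ : E → ℝ} (hφ : ContDiff ℝ 1 φ) (hφc : HasCompactSupport φ) (hφΩ : tsupport φ ⊆ Ω) :
    ∫ x in Ω, ⟪V x, ∇ φ x⟫ ∂μ = 0 := by
  let ψ : E → ℝ := fun x => φ (-x)
  have hψ : ContDiff ℝ 1 ψ := hφ.comp contDiff_neg
  have hψc : HasCompactSupport ψ := hφc.comp_homeomorph (Homeomorph.neg E)
  have hψΩ : tsupport ψ ⊆ Ω := by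
    rw [← hΩ, show ψ = φ ∘ Homeomorph.neg E from rfl, tsupport_comp_eq_preimage]
    exact preimage_mono hφΩ
  have hodd := setIntegral_inner_gradient_eq_zero_of_punctured hVi hV hdiv (hφ.sub hψ)
    (hφc.sub hψc) ((tsupport_sub _ _).trans (union_subset hφΩ hψΩ)) (by simp [ψ])
  have hswap : ∫ x in Ω, ⟪V x, ∇ ψ x⟫ ∂μ = -∫ x in Ω, ⟪V x, ∇ φ x⟫ ∂μ := by
    have h := (Measure.measurePreserving_neg μ).setIntegral_preimage_emb
      (Homeomorph.neg E).measurableEmbedding (fun x => ⟪V x, ∇ φ x⟫) Ω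
    rw [show Neg.neg ⁻¹' Ω = Ω from hΩ] at h
    simp only [hVeven] at h
    simp only [ψ, gradient_comp_neg, inner_neg_right, integral_neg, h]
  simp_rw [gradient_fun_sub (hφ.differentiable one_ne_zero _) (hψ.differentiable one_ne_zero _),
    inner_sub_right] at hodd
  rw [integral_sub (integrableOn_inner_gradient hVi hφ hφc)
    (integrableOn_inner_gradient hVi hψ hψc), hswap] at hodd
  linarith

end DivergenceFree

section LOneConvergence

variable {X V : Type*} [MeasurableSpace X] {μ : Measure X} [NormedAddCommGroup V]

lemma tendsto_integral_norm_sub_of_dominated {F : ℕ → X → V} {f : X → V} {M : X → ℝ}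
    (hF : ∀ k, AEStronglyMeasurable (F k) μ) (hM : Integrable M μ)
    (hFM : ∀ k, ∀ᵐ x ∂μ, ‖F k x‖ ≤ M x)
    (hlim : ∀ᵐ x ∂μ, Tendsto (fun k => F k x) atTop (𝓝 (f x))) :
    Integrable f μ ∧ Tendsto (fun k => ∫ x, ‖F k x - f x‖ ∂μ) atTop (𝓝 0) := by
  have hfm : AEStronglyMeasurable f μ := aestronglyMeasurable_of_tendsto_ae atTop hF hlim
  have hfM : ∀ᵐ x ∂μ, ‖f x‖ ≤ M x := by
    filter_upwards [hlim, ae_all_iff.2 hFM] with x hx hxM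
    exact le_of_tendsto hx.norm (.of_forall hxM)
  refine ⟨hM.mono' hfm hfM, ?_⟩
  rw [← integral_zero X ℝ (μ := μ)]
  refine tendsto_integral_of_dominated_convergence (fun x => M x + M x)
    (fun k => ((hF k).sub hfm).norm) (hM.add hM) (fun k => ?_) ?_
  · filter_upwards [hFM k, hfM] with x hx hfx
    rw [norm_norm]
    exact (norm_sub_le _ _).trans (add_le_add hx hfx)
  · filter_upwards [hlim] with x hx
    simpa using (hx.sub_const (f x)).norm

lemma tendsto_integral_mul_of_tendsto_integral_norm_sub {f : ℕ → X → ℝ} {g h : X → ℝ} {C : ℝ}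
    (hf : ∀ k, Integrable (f k) μ) (hg : Integrable g μ) (hh : AEStronglyMeasurable h μ)
    (hC : ∀ x, ‖h x‖ ≤ C) (hlim : Tendsto (fun k => ∫ x, ‖f k x - g x‖ ∂μ) atTop (𝓝 0)) :
    Tendsto (fun k => ∫ x, f k x * h x ∂μ) atTop (𝓝 (∫ x, g x * h x ∂μ)) := by
  have hC' : ∀ᵐ x ∂μ, ‖h x‖ ≤ C := .of_forall hC
  rw [tendsto_iff_norm_sub_tendsto_zero]
  refine squeeze_zero (fun _ => norm_nonneg _) (fun k => ?_) (by simpa using hlim.mul_const C)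
  rw [← integral_sub ((hf k).mul_bdd hh hC') (hg.mul_bdd hh hC'), ← integral_mul_const]
  refine norm_integral_le_of_norm_le (((hf k).sub hg).norm.mul_const C) (.of_forall fun x => ?_)
  rw [← sub_mul, norm_mul]
  exact mul_le_mul_of_nonneg_left (hC x) (norm_nonneg _)

end LOneConvergence

section Sobolev

variable {n : ℕ} {Ω : Set (EuclideanSpace ℝ (Fin n))}

lemma gradient_apply (f : EuclideanSpace ℝ (Fin n) → ℝ) (x : EuclideanSpace ℝ (Fin n))
    (i : Fin n) : (∇ f x) i = fderiv ℝ f x (EuclideanSpace.single i 1) := by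
  rw [← inner_gradient_left, EuclideanSpace.inner_single_right]
  simp

lemma IsTestFunction.contDiff_one {φ : EuclideanSpace ℝ (Fin n) → ℝ}
    (hφ : IsTestFunction Ω ⊤ φ) : ContDiff ℝ 1 φ :=
  hφ.1.of_le (by exact_mod_cast le_top)

lemma IsTestFunction.continuous_gradient_apply {φ : EuclideanSpace ℝ (Fin n) → ℝ}
    (hφ : IsTestFunction Ω ⊤ φ) (i : Fin n) : Continuous fun x => (∇ φ x) i :=
  (EuclideanSpace.proj i : EuclideanSpace ℝ (Fin n) →L[ℝ] ℝ).continuous.comp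
    (continuous_gradient hφ.contDiff_one)

lemma IsTestFunction.integrable {φ : EuclideanSpace ℝ (Fin n) → ℝ}
    (hφ : IsTestFunction Ω ⊤ φ) : Integrable φ :=
  hφ.contDiff_one.continuous.integrable_of_hasCompactSupport hφ.2.1

lemma IsTestFunction.hasCompactSupport_gradient {φ : EuclideanSpace ℝ (Fin n) → ℝ}
    (hφ : IsTestFunction Ω ⊤ φ) : HasCompactSupport (∇ φ) :=
  hφ.2.1.of_isClosed_subset (isClosed_tsupport _) (tsupport_gradient_subset φ)

lemma IsTestFunction.integrable_gradient {φ : EuclideanSpace ℝ (Fin n) → ℝ}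
    (hφ : IsTestFunction Ω ⊤ φ) : Integrable (∇ φ) :=
  (continuous_gradient hφ.contDiff_one).integrable_of_hasCompactSupport
    hφ.hasCompactSupport_gradient

lemma IsTestFunction.hasWeakGradient {φ : EuclideanSpace ℝ (Fin n) → ℝ}
    (hφ : IsTestFunction Ω ⊤ φ) : HasWeakGradient Ω φ (∇ φ) where
  locallyIntegrableOn := hφ.integrable.integrableOn.locallyIntegrableOn
  locallyIntegrableOn_grad := hφ.integrable_gradient.integrableOn.locallyIntegrableOn
  integral_eq ψ hψ i := by
    have hφ0 : ∀ x ∉ Ω, φ x = 0 := fun x hx =>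
      image_eq_zero_of_notMem_tsupport fun h => hx (hφ.2.2 h)
    have hψ0 : ∀ x ∉ Ω, ψ x = 0 := fun x hx =>
      image_eq_zero_of_notMem_tsupport fun h => hx (hψ.2.2 h)
    rw [setIntegral_eq_integral_of_forall_compl_eq_zero fun x hx => by rw [hφ0 x hx, zero_mul],
      setIntegral_eq_integral_of_forall_compl_eq_zero fun x hx => by rw [hψ0 x hx, mul_zero]]
    have hint₁ : Integrable fun x => (∇ φ x) i * ψ x :=
      ((hφ.continuous_gradient_apply i).mul hψ.contDiff_one.continuous)
        |>.integrable_of_hasCompactSupport hψ.2.1.mul_left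
    have hint₂ : Integrable fun x => φ x * (∇ ψ x) i :=
      (hφ.contDiff_one.continuous.mul (hψ.continuous_gradient_apply i))
        |>.integrable_of_hasCompactSupport hφ.2.1.mul_right
    simp only [gradient_apply] at hint₁ hint₂ ⊢
    exact integral_mul_fderiv_eq_neg_fderiv_mul_of_integrable hint₁ hint₂
      ((hφ.contDiff_one.continuous.mul hψ.contDiff_one.continuous).integrable_of_hasCompactSupport
        hφ.2.1.mul_right)
      (fun x _ => hφ.contDiff_one.differentiable one_ne_zero x)
      fun x _ => hψ.contDiff_one.differentiable one_ne_zero x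

lemma HasWeakGradient.of_tendsto {u : EuclideanSpace ℝ (Fin n) → ℝ}
    {G : EuclideanSpace ℝ (Fin n) → EuclideanSpace ℝ (Fin n)}
    {uk : ℕ → EuclideanSpace ℝ (Fin n) → ℝ}
    {Gk : ℕ → EuclideanSpace ℝ (Fin n) → EuclideanSpace ℝ (Fin n)}
    (hw : ∀ k, HasWeakGradient Ω (uk k) (Gk k)) (huk : ∀ k, IntegrableOn (uk k) Ω)
    (hGk : ∀ k, IntegrableOn (Gk k) Ω) (hu : IntegrableOn u Ω) (hG : IntegrableOn G Ω)
    (hlimu : Tendsto (fun k => ∫ x in Ω, ‖uk k x - u x‖) atTop (𝓝 0))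
    (hlimG : Tendsto (fun k => ∫ x in Ω, ‖Gk k x - G x‖) atTop (𝓝 0)) :
    HasWeakGradient Ω u G := by
  refine ⟨hu.locallyIntegrableOn, hG.locallyIntegrableOn, fun ψ hψ i => ?_⟩
  have hcoord : ∀ {H : EuclideanSpace ℝ (Fin n) → EuclideanSpace ℝ (Fin n)},
      IntegrableOn H Ω → IntegrableOn (fun x => H x i) Ω := fun hH =>
    (EuclideanSpace.proj i : EuclideanSpace ℝ (Fin n) →L[ℝ] ℝ).integrable_comp hH
  obtain ⟨C₁, hC₁⟩ := hψ.contDiff_one.continuous.bounded_above_of_compact_support hψ.2.1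
  obtain ⟨C₂, hC₂⟩ := (continuous_gradient hψ.contDiff_one).bounded_above_of_compact_support
    hψ.hasCompactSupport_gradient
  have hleft := tendsto_integral_mul_of_tendsto_integral_norm_sub huk hu
    (hψ.continuous_gradient_apply i).aestronglyMeasurable
    (fun x => (PiLp.norm_apply_le (∇ ψ x) i).trans (hC₂ x)) hlimu
  have hlimGi : Tendsto (fun k => ∫ x in Ω, ‖Gk k x i - G x i‖) atTop (𝓝 0) :=
    squeeze_zero (fun _ => integral_nonneg fun _ => norm_nonneg _)
      (fun k => integral_mono ((hcoord (hGk k)).sub (hcoord hG)).norm ((hGk k).sub hG).norm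
        fun x => PiLp.norm_apply_le (Gk k x - G x) i) hlimG
  have hright := tendsto_integral_mul_of_tendsto_integral_norm_sub (fun k => hcoord (hGk k))
    (hcoord hG) hψ.contDiff_one.continuous.aestronglyMeasurable hC₁ hlimGi
  exact tendsto_nhds_unique hleft
    (hright.neg.congr fun k => ((hw k).integral_eq ψ hψ i).symm)

/-- The approximating test functions are `cutoff ρ k * u`; the bound on `|u| ‖∇ρ‖` controls the
term of their gradients in which the cutoff is differentiated. -/
lemma hasWeakGradient_and_memW11Zero_of_dominated (hΩ : Bornology.IsBounded Ω)
    {ρ u M : EuclideanSpace ℝ (Fin n) → ℝ} (hρ : ContDiff ℝ (⊤ : ℕ∞) ρ)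
    (hρΩ : ∀ x, 0 < ρ x → x ∈ Ω) (hρpos : ∀ᵐ x ∂volume.restrict Ω, 0 < ρ x)
    (hu : ∀ x, 0 < ρ x → ContDiffAt ℝ (⊤ : ℕ∞) u x) (hM : IntegrableOn M Ω)
    (huM : ∀ x, 0 < ρ x → ‖u x‖ ≤ M x) (hgrad : ∀ x, 0 < ρ x → ‖∇ u x‖ ≤ M x)
    (huρ : ∀ x, 0 < ρ x → |u x| * ‖∇ ρ x‖ ≤ M x * ρ x) :
    HasWeakGradient Ω u (∇ u) ∧ MemW11Zero Ω u := by
  let φ : ℕ → EuclideanSpace ℝ (Fin n) → ℝ := fun k x => cutoff ρ k x * u x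
  have hsupp : ∀ k, tsupport (φ k) ⊆ Ω := fun k x hx =>
    hρΩ x (tsupport_cutoff_subset hρ.continuous k (tsupport_mul_subset_left hx))
  have hφ : ∀ k, IsTestFunction Ω ⊤ (φ k) := fun k => ⟨contDiff_cutoff_mul hρ hu k,
    Metric.isCompact_of_isClosed_isBounded (isClosed_tsupport _) (hΩ.subset (hsupp k)), hsupp k⟩
  have hstab : ∀ x, 0 < ρ x → ∀ᶠ k in atTop, φ k =ᶠ[𝓝 x] u := fun x hx =>
    eventually_cutoff_mul_eventuallyEq hρ.continuous.continuousAt hx u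
  obtain ⟨C, hC⟩ := exists_norm_gradient_cutoff_mul_le (F := EuclideanSpace ℝ (Fin n))
  obtain ⟨hui, hlimu⟩ := tendsto_integral_norm_sub_of_dominated (f := u)
    (fun k => (hφ k).integrable.integrableOn.aestronglyMeasurable) hM
    (fun k => hρpos.mono fun x hx => (norm_cutoff_smul_le ρ k x (u x)).trans (huM x hx))
    (hρpos.mono fun x hx => tendsto_const_nhds.congr' <|
      (hstab x hx).mono fun k hk => hk.eq_of_nhds.symm)
  obtain ⟨hGi, hlimG⟩ := tendsto_integral_norm_sub_of_dominated (f := ∇ u)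
    (fun k => (hφ k).integrable_gradient.integrableOn.aestronglyMeasurable) (hM.const_mul C)
    (fun k => hρpos.mono fun x hx => hC ρ u _ _ x _ k
      (hρ.differentiable (by simp) x).hasGradientAt
      ((hu x hx).differentiableAt (by simp)).hasGradientAt hx (hgrad x hx) (huρ x hx))
    (hρpos.mono fun x hx => tendsto_const_nhds.congr' <|
      (hstab x hx).mono fun k hk => hk.gradient_eq.symm)
  have hw : HasWeakGradient Ω u (∇ u) :=
    .of_tendsto (fun k => (hφ k).hasWeakGradient) (fun k => (hφ k).integrable.integrableOn)
      (fun k => (hφ k).integrable_gradient.integrableOn) hui hGi hlimu hlimG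
  exact ⟨hw, ∇ u, hw, hui, hGi, φ, hφ, hlimu, hlimG⟩

end Sobolev

section Dipole

variable {E : Type*} [NormedAddCommGroup E] [InnerProductSpace ℝ E] {e x : E} {κ a b : ℝ → ℝ}

/-- The dipole function with moment `e` and radial profile `κ`, where `κ` is a function of
`log ‖x‖`. -/
noncomputable def dipole (e : E) (κ : ℝ → ℝ) (x : E) : ℝ := ⟪e, x⟫ * κ (Real.log ‖x‖)

/-- The dipole field with moment `e`, with profile `a` in the direction `e` and profile `b` in the
radial direction; gradients of dipoles are of this form. -/
noncomputable def dipoleField (e : E) (a b : ℝ → ℝ) (x : E) : E :=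
  a (Real.log ‖x‖) • e + (b (Real.log ‖x‖) * (⟪e, x⟫ / ‖x‖ ^ 2)) • x

lemma dipoleField_neg (e : E) (a b : ℝ → ℝ) (x : E) :
    dipoleField e a b (-x) = dipoleField e a b x := by
  simp [dipoleField, neg_div]

lemma abs_dipole_le (e : E) (κ : ℝ → ℝ) (x : E) :
    |dipole e κ x| ≤ ‖e‖ * ‖x‖ * |κ (Real.log ‖x‖)| := by
  rw [dipole, abs_mul]
  gcongr
  exact abs_real_inner_le_norm e x

lemma abs_dipole_le_mul_one_sub_norm_sq {c : ℝ} (hx : x ≠ 0)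
    (hκ : |κ (Real.log ‖x‖)| ≤ c * (1 - Real.exp (2 * Real.log ‖x‖))) :
    |dipole e κ x| ≤ ‖e‖ * ‖x‖ * (c * (1 - ‖x‖ ^ 2)) := by
  rw [two_mul, Real.exp_add, Real.exp_log (norm_pos_iff.2 hx), ← sq] at hκ
  exact (abs_dipole_le e κ x).trans (by gcongr)

lemma norm_dipoleField_le {M : ℝ} (ha : |a (Real.log ‖x‖)| ≤ M) (hb : |b (Real.log ‖x‖)| ≤ M) :
    ‖dipoleField e a b x‖ ≤ 2 * ‖e‖ * M := by
  have hradial : |⟪e, x⟫ / ‖x‖ ^ 2| * ‖x‖ ≤ ‖e‖ := by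
    rcases eq_or_ne x 0 with rfl | hx
    · simp
    have hx' : 0 < ‖x‖ := norm_pos_iff.2 hx
    rw [abs_div, abs_of_pos (pow_pos hx' 2), div_mul_eq_mul_div, div_le_iff₀ (by positivity)]
    nlinarith [abs_real_inner_le_norm e x]
  calc ‖dipoleField e a b x‖
      ≤ |a (Real.log ‖x‖)| * ‖e‖ + |b (Real.log ‖x‖)| * (|⟪e, x⟫ / ‖x‖ ^ 2| * ‖x‖) := by
        refine (norm_add_le _ _).trans_eq ?_
        rw [norm_smul, norm_smul, Real.norm_eq_abs, Real.norm_eq_abs, abs_mul, mul_assoc]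
    _ ≤ M * ‖e‖ + M * ‖e‖ := by gcongr; exact (abs_nonneg _).trans hb
    _ = 2 * ‖e‖ * M := by ring

lemma contDiffAt_comp_log_norm {m : WithTop ℕ∞} (hκ : ContDiff ℝ m κ) (hx : x ≠ 0) :
    ContDiffAt ℝ m (fun y : E => κ (Real.log ‖y‖)) x :=
  hκ.contDiffAt.comp x ((contDiffAt_norm ℝ hx).log (norm_ne_zero_iff.2 hx))

lemma contDiffAt_dipole {m : WithTop ℕ∞} (hκ : ContDiff ℝ m κ) (hx : x ≠ 0) :
    ContDiffAt ℝ m (dipole e κ) x :=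
  (contDiffAt_const.inner ℝ contDiffAt_id).mul (contDiffAt_comp_log_norm hκ hx)

lemma contDiffAt_dipoleField {m : WithTop ℕ∞} (ha : ContDiff ℝ m a) (hb : ContDiff ℝ m b)
    (hx : x ≠ 0) : ContDiffAt ℝ m (dipoleField e a b) x :=
  ((contDiffAt_comp_log_norm ha hx).smul contDiffAt_const).add
    (((contDiffAt_comp_log_norm hb hx).mul ((contDiffAt_const.inner ℝ contDiffAt_id).div
      (contDiff_norm_sq ℝ).contDiffAt (by simpa using hx))).smul contDiffAt_id)

lemma measurable_dipoleField [MeasurableSpace E] [BorelSpace E] [SecondCountableTopology E]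
    (e : E) (ha : Measurable a) (hb : Measurable b) : Measurable (dipoleField e a b) :=
  ((ha.comp (measurable_norm.log)).smul_const e).add
    (((hb.comp (measurable_norm.log)).mul
      ((measurable_const.inner measurable_id).div (measurable_norm.pow_const 2))).smul
        measurable_id)

section Gradient

variable [CompleteSpace E]

lemma hasGradientAt_comp_log_norm (hκ : Differentiable ℝ κ) (hx : x ≠ 0) :
    HasGradientAt (fun y : E => κ (Real.log ‖y‖)) ((deriv κ (Real.log ‖x‖) / ‖x‖ ^ 2) • x) x := by
  rw [div_eq_mul_inv, mul_smul]
  exact hasGradientAt_comp (f := fun y : E => Real.log ‖y‖) (hκ _).hasDerivAt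
    (hasGradientAt_log_norm hx)

lemma gradient_dipole (hκ : Differentiable ℝ κ) (hx : x ≠ 0) :
    ∇ (dipole e κ) x = dipoleField e κ (deriv κ) x := by
  refine (hasGradientAt_mul (hasGradientAt_inner_left e x)
    (hasGradientAt_comp_log_norm hκ hx)).gradient.trans ?_
  rw [dipoleField, add_comm, smul_smul, mul_div_left_comm]

lemma hasGradientAt_inner_div_norm_sq (hx : x ≠ 0) : HasGradientAt (fun y => ⟪e, y⟫ / ‖y‖ ^ 2)
    ((‖x‖ ^ 2)⁻¹ • e - (2 * ⟪e, x⟫ / (‖x‖ ^ 2) ^ 2) • x) x := by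
  have hx2 : ‖x‖ ^ 2 ≠ 0 := by simpa using hx
  convert hasGradientAt_mul (hasGradientAt_inner_left e x)
    (hasGradientAt_comp (f := fun y : E => ‖y‖ ^ 2) (hasDerivAt_inv hx2)
      (hasGradientAt_norm_sq x)) using 1
  · simp only [div_eq_mul_inv]
  · module

end Gradient

variable [FiniteDimensional ℝ E]

lemma divergence_comp_log_norm_smul_const (ha : Differentiable ℝ a) (hx : x ≠ 0) :
    divergence (fun y : E => a (Real.log ‖y‖) • e) x =
      deriv a (Real.log ‖x‖) * (⟪e, x⟫ / ‖x‖ ^ 2) := by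
  have h := hasGradientAt_comp_log_norm ha hx
  rw [divergence_smul (V := fun _ => e) h.differentiableAt (differentiableAt_const e),
    h.gradient, inner_smul_right]
  simp [divergence, div_mul_eq_mul_div, mul_div_assoc]

lemma divergence_mul_inner_div_norm_sq_smul (hb : Differentiable ℝ b) (hx : x ≠ 0) :
    divergence (fun y : E => (b (Real.log ‖y‖) * (⟪e, y⟫ / ‖y‖ ^ 2)) • id y) x =
      (deriv b (Real.log ‖x‖) + (Module.finrank ℝ E - 1) * b (Real.log ‖x‖)) *
        (⟪e, x⟫ / ‖x‖ ^ 2) := by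
  have hx2 : ‖x‖ ≠ 0 := by simpa using hx
  have h := hasGradientAt_mul (hasGradientAt_comp_log_norm hb hx)
    (hasGradientAt_inner_div_norm_sq (e := e) hx)
  rw [divergence_smul h.differentiableAt differentiableAt_id, h.gradient, divergence_id]
  simp only [id, inner_add_right, inner_sub_right, inner_smul_right, real_inner_self_eq_norm_sq,
    real_inner_comm x e]
  field_simp
  ring

lemma divergence_dipoleField (ha : Differentiable ℝ a) (hb : Differentiable ℝ b) (hx : x ≠ 0) :
    divergence (dipoleField e a b) x = (deriv a (Real.log ‖x‖) + deriv b (Real.log ‖x‖) +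
      (Module.finrank ℝ E - 1) * b (Real.log ‖x‖)) * (⟪e, x⟫ / ‖x‖ ^ 2) := by
  have hasum := divergence_add
    ((hasGradientAt_comp_log_norm ha hx).differentiableAt.smul_const e)
    (((hasGradientAt_comp_log_norm hb hx).differentiableAt.fun_mul
      (hasGradientAt_inner_div_norm_sq (e := e) hx).differentiableAt).fun_smul differentiableAt_id)
  refine hasum.trans ?_
  rw [divergence_comp_log_norm_smul_const ha hx, divergence_mul_inner_div_norm_sq_smul hb hx]
  ring

/-- If `h = (κ'' + n κ') / (n - 1)`, then a medium whose tangential conductivity is `1 + h / κ`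
and whose radial conductivity is `1` turns the gradient of the dipole into a divergence-free
flux. -/
lemma divergence_dipoleField_add_sub {h : ℝ → ℝ} (hκ : Differentiable ℝ κ)
    (hκ' : Differentiable ℝ (deriv κ)) (hh : Differentiable ℝ h)
    (heq : ∀ τ, (Module.finrank ℝ E - 1) * h τ =
      deriv (deriv κ) τ + Module.finrank ℝ E * deriv κ τ) (hx : x ≠ 0) :
    divergence (dipoleField e (κ + h) (deriv κ - h)) x = 0 := by
  rw [divergence_dipoleField (hκ.add hh) (hκ'.sub hh) hx, deriv_add (hκ _) (hh _),
    deriv_sub (hκ' _) (hh _), Pi.sub_apply]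
  linear_combination (-(⟪e, x⟫ / ‖x‖ ^ 2)) * heq (Real.log ‖x‖)

end Dipole

section Radial

variable {E : Type*} [NormedAddCommGroup E] [NormedSpace ℝ E] [FiniteDimensional ℝ E]
  [MeasurableSpace E] [BorelSpace E] [Nontrivial E] {F : Type*} [NormedAddCommGroup F]
  [NormedSpace ℝ F]

lemma integrable_comp_log_norm_iff (μ : Measure E) [μ.IsAddHaarMeasure] {g : ℝ → F} :
    Integrable (fun x => g (Real.log ‖x‖)) μ ↔
      Integrable fun τ => Real.exp (Module.finrank ℝ E * τ) • g τ := by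
  rw [integrable_fun_norm_addHaar μ (f := fun r => g (Real.log r)), ← Real.range_exp,
    ← image_univ, integrableOn_image_iff_integrableOn_abs_deriv_smul MeasurableSet.univ
    (fun τ _ => (Real.hasDerivAt_exp τ).hasDerivWithinAt) Real.exp_injective.injOn,
    integrableOn_univ]
  refine integrable_congr (.of_forall fun τ => ?_)
  have hpow : Real.exp τ * Real.exp τ ^ (Module.finrank ℝ E - 1) =
      Real.exp (Module.finrank ℝ E * τ) := by
    rw [mul_pow_sub_one Module.finrank_pos.ne', ← Real.exp_nat_mul]
  simp only [smul_smul, Real.log_exp, abs_of_pos (Real.exp_pos τ), hpow]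

end Radial

section Ball

lemma log_norm_neg {F : Type*} [NormedAddCommGroup F] {x : F} (hx0 : x ≠ 0)
    (hx : x ∈ Metric.ball 0 1) : Real.log ‖x‖ < 0 :=
  Real.log_neg (norm_pos_iff.2 hx0) (mem_ball_zero_iff.1 hx)

lemma norm_sq_mul_one_sub_norm_sq_pos_iff {F : Type*} [NormedAddCommGroup F] {x : F} :
    0 < ‖x‖ ^ 2 * (1 - ‖x‖ ^ 2) ↔ x ≠ 0 ∧ x ∈ Metric.ball 0 1 := by
  rw [mem_ball_zero_iff, ← norm_pos_iff]
  constructor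
  · intro h
    have hx : 0 < ‖x‖ := (norm_nonneg x).lt_of_ne fun h0 => by simp [← h0] at h
    have h1 : ‖x‖ ^ 2 < 1 := sub_pos.1 (pos_of_mul_pos_right h (by positivity))
    exact ⟨hx, (sq_lt_one_iff₀ hx.le).1 h1⟩
  · rintro ⟨hx, h1⟩
    exact mul_pos (pow_pos hx 2) (sub_pos.2 ((sq_lt_one_iff₀ hx.le).2 h1))

lemma norm_gradient_norm_sq_mul_one_sub_norm_sq_le {F : Type*} [NormedAddCommGroup F]
    [InnerProductSpace ℝ F] [CompleteSpace F] {x : F} (hx : x ∈ Metric.ball 0 1) :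
    ‖∇ (fun y : F => ‖y‖ ^ 2 * (1 - ‖y‖ ^ 2)) x‖ ≤ 2 * ‖x‖ := by
  have hquad : HasDerivAt (fun s : ℝ => s * (1 - s)) (1 - 2 * ‖x‖ ^ 2) (‖x‖ ^ 2) := by
    refine ((hasDerivAt_id' (‖x‖ ^ 2)).fun_mul
      ((hasDerivAt_id' (‖x‖ ^ 2)).const_sub 1)).congr_deriv ?_
    ring
  have hx1 : ‖x‖ ^ 2 < 1 := (sq_lt_one_iff₀ (norm_nonneg x)).2 (mem_ball_zero_iff.1 hx)
  have habs : |1 - 2 * ‖x‖ ^ 2| ≤ 1 := abs_le.2 ⟨by linarith, by linarith [sq_nonneg ‖x‖]⟩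
  rw [(hasGradientAt_comp (f := fun y : F => ‖y‖ ^ 2) hquad (hasGradientAt_norm_sq x)).gradient,
    norm_smul, norm_smul, Real.norm_two, Real.norm_eq_abs]
  exact mul_le_of_le_one_left (by positivity) habs

lemma not_ae_dipole_eq_zero {E : Type*} [NormedAddCommGroup E] [InnerProductSpace ℝ E]
    [MeasurableSpace E] [OpensMeasurableSpace E] (μ : Measure E) [μ.IsOpenPosMeasure] {e : E}
    {κ : ℝ → ℝ} (he : e ≠ 0) (hκ : Continuous κ)
    (hκ0 : ∃ τ < 0, κ τ ≠ 0) :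
    ¬ ∀ᵐ x ∂μ.restrict (Metric.ball 0 1), dipole e κ x = 0 := by
  obtain ⟨τ, hτ, hκτ⟩ := hκ0
  intro h
  have he' : ‖e‖ ≠ 0 := norm_ne_zero_iff.2 he
  let p := (Real.exp τ / ‖e‖) • e
  have hp : ‖p‖ = Real.exp τ := by
    rw [norm_smul, Real.norm_of_nonneg (by positivity), div_mul_cancel₀ _ he']
  have hp0 : p ≠ 0 := norm_ne_zero_iff.1 (hp ▸ (Real.exp_pos τ).ne')
  have hpb : p ∈ Metric.ball 0 1 := mem_ball_zero_iff.2 (hp ▸ Real.exp_lt_one_iff.2 hτ)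
  have hup : dipole e κ p ≠ 0 := by
    rw [dipole, hp, Real.log_exp, inner_smul_right, real_inner_self_eq_norm_sq]
    positivity
  have hcont : ContinuousAt (dipole e κ) p :=
    (contDiffAt_dipole (contDiff_zero.2 hκ) hp0).continuousAt
  rw [ae_restrict_iff' measurableSet_ball] at h
  refine (Measure.measure_pos_of_mem_nhds μ (x := p) ?_).ne' (ae_iff.1 h)
  filter_upwards [Metric.isOpen_ball.mem_nhds hpb, hcont.eventually_ne hup] with x hx hx'
  exact fun h => hx' (h hx)

lemma integrableOn_dipoleField {E : Type*} [NormedAddCommGroup E] [InnerProductSpace ℝ E]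
    [FiniteDimensional ℝ E] [Nontrivial E] [MeasurableSpace E] [BorelSpace E] {μ : Measure E}
    [μ.IsAddHaarMeasure] {e : E} {a b m : ℝ → ℝ}
    (hm : Integrable fun τ => Real.exp (Module.finrank ℝ E * τ) * m τ)
    (ha : Measurable a) (hb : Measurable b) (ham : ∀ τ < 0, |a τ| ≤ m τ)
    (hbm : ∀ τ < 0, |b τ| ≤ m τ) : IntegrableOn (dipoleField e a b) (Metric.ball 0 1) μ := by
  have hM : Integrable (fun x : E => m (Real.log ‖x‖)) μ := (integrable_comp_log_norm_iff μ).2 hm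
  refine (hM.const_mul (2 * ‖e‖)).integrableOn.mono'
    (measurable_dipoleField e ha hb).aestronglyMeasurable ?_
  filter_upwards [ae_restrict_mem measurableSet_ball, ae_restrict_of_ae (Measure.ae_ne μ 0)]
    with x hx hx0
  exact norm_dipoleField_le (ham _ (log_norm_neg hx0 hx)) (hbm _ (log_norm_neg hx0 hx))

lemma hasWeakGradient_and_memW11Zero_dipole {n : ℕ} [Nontrivial (EuclideanSpace ℝ (Fin n))]
    {e : EuclideanSpace ℝ (Fin n)} {κ m : ℝ → ℝ}
    (hκ : ContDiff ℝ (⊤ : ℕ∞) κ) (hm : Integrable fun τ => Real.exp (n * τ) * m τ)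
    (hκm : ∀ τ < 0, |κ τ| ≤ m τ * (1 - Real.exp (2 * τ))) (hκm' : ∀ τ < 0, |deriv κ τ| ≤ m τ) :
    HasWeakGradient (Metric.ball 0 1) (dipole e κ) (∇ (dipole e κ)) ∧
      MemW11Zero (Metric.ball 0 1) (dipole e κ) := by
  have hκm₀ : ∀ τ < 0, |κ τ| ≤ m τ := fun τ hτ => (hκm τ hτ).trans
    (mul_le_of_le_one_right ((abs_nonneg _).trans (hκm' τ hτ)) (by linarith [Real.exp_pos (2 * τ)]))
  have hM : Integrable fun x : EuclideanSpace ℝ (Fin n) => m (Real.log ‖x‖) :=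
    (integrable_comp_log_norm_iff volume).2 (by simpa using hm)
  refine hasWeakGradient_and_memW11Zero_of_dominated Metric.isBounded_ball
    (ρ := fun x => ‖x‖ ^ 2 * (1 - ‖x‖ ^ 2)) (M := fun x => 2 * ‖e‖ * m (Real.log ‖x‖))
    ((contDiff_norm_sq ℝ).mul (contDiff_const.sub (contDiff_norm_sq ℝ)))
    (fun x hx => (norm_sq_mul_one_sub_norm_sq_pos_iff.1 hx).2) ?_
    (fun x hx => contDiffAt_dipole hκ (norm_sq_mul_one_sub_norm_sq_pos_iff.1 hx).1)
    (hM.const_mul _).integrableOn ?_ ?_ ?_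
  · filter_upwards [ae_restrict_mem measurableSet_ball,
      ae_restrict_of_ae (Measure.ae_ne volume 0)] with x hx hx0
    exact norm_sq_mul_one_sub_norm_sq_pos_iff.2 ⟨hx0, hx⟩
  all_goals
    intro x hx
    obtain ⟨hx0, hxb⟩ := norm_sq_mul_one_sub_norm_sq_pos_iff.1 hx
    have hτ := log_norm_neg hx0 hxb
    have hκx := hκm₀ _ hτ
  · calc |dipole e κ x| ≤ ‖e‖ * ‖x‖ * |κ (Real.log ‖x‖)| := abs_dipole_le e κ x
      _ ≤ ‖e‖ * 2 * m (Real.log ‖x‖) := by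
        gcongr
        linarith [mem_ball_zero_iff.1 hxb]
      _ = 2 * ‖e‖ * m (Real.log ‖x‖) := by ring
  · rw [gradient_dipole (hκ.differentiable (by simp)) hx0]
    exact norm_dipoleField_le hκx (hκm' _ hτ)
  · have hux := abs_dipole_le_mul_one_sub_norm_sq (e := e) hx0 (hκm _ hτ)
    refine (mul_le_mul hux (norm_gradient_norm_sq_mul_one_sub_norm_sq_le hxb) (norm_nonneg _)
      ((abs_nonneg _).trans hux)).trans_eq ?_
    ring

end Ball

section TangentialMedium

variable {n : ℕ} {α : ℝ → ℝ}

/-- The coefficient matrix with eigenvalue `1` in the radial direction and eigenvalue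
`1 + α (log ‖x‖)` in the tangential directions. At the origin it is `(1 + α 0) • 1`, because
`Real.log 0 = 0` and `0⁻¹ = 0`. -/
noncomputable def tangentialMedium (α : ℝ → ℝ) (x : EuclideanSpace ℝ (Fin n)) :
    Matrix (Fin n) (Fin n) ℝ :=
  1 + α (Real.log ‖x‖) • (1 - (‖x‖ ^ 2)⁻¹ • Matrix.vecMulVec x.ofLp x.ofLp)

lemma dotProduct_ofLp (x y : EuclideanSpace ℝ (Fin n)) : x.ofLp ⬝ᵥ y.ofLp = ⟪x, y⟫ := by
  rw [EuclideanSpace.inner_eq_star_dotProduct, star_trivial, dotProduct_comm]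

lemma tangentialMedium_mulVec (α : ℝ → ℝ) (x ξ : EuclideanSpace ℝ (Fin n)) :
    tangentialMedium α x *ᵥ ξ.ofLp =
      (ξ + α (Real.log ‖x‖) • (ξ - (⟪x, ξ⟫ / ‖x‖ ^ 2) • x)).ofLp := by
  rw [tangentialMedium, Matrix.add_mulVec, Matrix.smul_mulVec, Matrix.sub_mulVec,
    Matrix.one_mulVec, Matrix.smul_mulVec, Matrix.vecMulVec_mulVec, dotProduct_ofLp]
  ext i
  simp only [PiLp.add_apply, PiLp.smul_apply, PiLp.sub_apply, Pi.add_apply, Pi.smul_apply,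
    Pi.sub_apply, op_smul_eq_smul, smul_eq_mul]
  ring

lemma tangentialMedium_mulVec_dipoleField {κ b : ℝ → ℝ} {e x : EuclideanSpace ℝ (Fin n)}
    (hx : x ≠ 0) : tangentialMedium α x *ᵥ (dipoleField e κ b x).ofLp =
      (dipoleField e (κ + α * κ) (b - α * κ) x).ofLp := by
  have hx2 : ‖x‖ ≠ 0 := by simpa using hx
  rw [tangentialMedium_mulVec]
  congr 1
  simp only [dipoleField, Pi.add_apply, Pi.sub_apply, Pi.mul_apply, inner_add_right,
    inner_smul_right, real_inner_self_eq_norm_sq, real_inner_comm e x]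
  rw [add_div, mul_div_cancel_right₀ _ (pow_ne_zero 2 hx2)]
  module

lemma isElliptic_tangentialMedium {Ω : Set (EuclideanSpace ℝ (Fin n))} {c : ℝ} (hc : c < 1)
    (hα : ∀ x ∈ Ω, |α (Real.log ‖x‖)| ≤ c) : IsElliptic Ω (tangentialMedium α) := by
  refine ⟨1 - c, 1 + |c|, by linarith, by positivity, fun x hx => ⟨?_, fun ξ => ?_⟩⟩
  · rw [tangentialMedium, Matrix.IsSymm, Matrix.transpose_add, Matrix.transpose_smul,
      Matrix.transpose_sub, Matrix.transpose_smul, Matrix.transpose_one,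
      Matrix.transpose_vecMulVec]
  have hform : (tangentialMedium α x *ᵥ ξ.ofLp) ⬝ᵥ ξ.ofLp =
      ‖ξ‖ ^ 2 + α (Real.log ‖x‖) * (‖ξ‖ ^ 2 - ⟪x, ξ⟫ ^ 2 / ‖x‖ ^ 2) := by
    rw [tangentialMedium_mulVec, dotProduct_ofLp, inner_add_left, real_inner_smul_left,
      inner_sub_left, real_inner_smul_left, real_inner_self_eq_norm_sq]
    ring
  have hproj : ⟪x, ξ⟫ ^ 2 / ‖x‖ ^ 2 ≤ ‖ξ‖ ^ 2 := by
    rw [← sq_abs ⟪x, ξ⟫]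
    refine div_le_of_le_mul₀ (sq_nonneg _) (sq_nonneg _) ?_
    rw [← mul_pow, mul_comm]
    gcongr
    exact abs_real_inner_le_norm x ξ
  have hpert : |α (Real.log ‖x‖) * (‖ξ‖ ^ 2 - ⟪x, ξ⟫ ^ 2 / ‖x‖ ^ 2)| ≤ c * ‖ξ‖ ^ 2 := by
    rw [abs_mul, abs_of_nonneg (sub_nonneg.2 hproj)]
    refine mul_le_mul (hα x hx) (sub_le_self _ (by positivity)) (sub_nonneg.2 hproj)
      ((abs_nonneg _).trans (hα x hx))
  rw [hform]
  constructor <;> nlinarith [abs_le.1 hpert, le_abs_self c, sq_nonneg ‖ξ‖]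

lemma continuousAt_tangentialMedium_zero (hα0 : α 0 = 0) (hlim : Tendsto α atBot (𝓝 0)) :
    ContinuousAt (tangentialMedium (n := n) α) 0 := by
  have hlog : Tendsto (fun y : EuclideanSpace ℝ (Fin n) => α (Real.log ‖y‖)) (𝓝[≠] 0) (𝓝 0) :=
    hlim.comp (Real.tendsto_log_nhdsGT_zero.comp tendsto_norm_nhdsNE_zero)
  have hzero : tangentialMedium α (0 : EuclideanSpace ℝ (Fin n)) = 1 := by
    simp [tangentialMedium, hα0]
  rw [continuousAt_iff_punctured_nhds, hzero]
  refine tendsto_pi_nhds.2 fun i => tendsto_pi_nhds.2 fun j => ?_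
  have hbdd : ∀ y : EuclideanSpace ℝ (Fin n),
      |(1 - (‖y‖ ^ 2)⁻¹ • Matrix.vecMulVec y.ofLp y.ofLp : Matrix (Fin n) (Fin n) ℝ) i j| ≤ 2 := by
    intro y
    have hδ : |(1 : Matrix (Fin n) (Fin n) ℝ) i j| ≤ 1 := by
      rw [Matrix.one_apply]
      split_ifs <;> simp
    have hproj : |(‖y‖ ^ 2)⁻¹ * (y i * y j)| ≤ 1 := by
      rw [inv_mul_eq_div, abs_div, abs_mul, abs_of_nonneg (sq_nonneg ‖y‖), sq]
      exact div_le_one_of_le₀ (mul_le_mul (PiLp.norm_apply_le y i) (PiLp.norm_apply_le y j)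
        (abs_nonneg _) (norm_nonneg _)) (by positivity)
    exact (abs_sub _ _).trans ((add_le_add hδ hproj).trans_eq one_add_one_eq_two)
  have hprod := hlog.zero_mul_isBoundedUnder_le (isBoundedUnder_of ⟨2, hbdd⟩)
  simpa [tangentialMedium] using hprod.const_add ((1 : Matrix (Fin n) (Fin n) ℝ) i j)

lemma continuousOn_tangentialMedium (hα : ContinuousOn α (Iio 0)) (hα0 : α 0 = 0)
    (hlim : Tendsto α atBot (𝓝 0)) :
    ContinuousOn (tangentialMedium (n := n) α) (Metric.ball 0 1) := by
  intro x hx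
  refine ContinuousAt.continuousWithinAt ?_
  rcases eq_or_ne x 0 with rfl | hx0
  · exact continuousAt_tangentialMedium_zero hα0 hlim
  · have hlog : ContinuousAt (fun y : EuclideanSpace ℝ (Fin n) => α (Real.log ‖y‖)) x :=
      (hα.continuousAt (Iio_mem_nhds (log_norm_neg hx0 hx))).comp
        (f := fun y : EuclideanSpace ℝ (Fin n) => Real.log ‖y‖)
        (continuous_norm.continuousAt.log (norm_ne_zero_iff.2 hx0))
    have hinv : ContinuousAt (fun y : EuclideanSpace ℝ (Fin n) => (‖y‖ ^ 2)⁻¹) x :=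
      (continuous_norm.pow 2).continuousAt.inv₀ (by simpa using hx0)
    have hmat : Continuous fun y : EuclideanSpace ℝ (Fin n) => Matrix.vecMulVec y.ofLp y.ofLp :=
      Continuous.matrix_vecMulVec (by fun_prop) (by fun_prop)
    exact continuousAt_const.add (hlog.smul (continuousAt_const.sub (hinv.smul hmat.continuousAt)))

lemma isWeakSolution_dipole [Nontrivial (EuclideanSpace ℝ (Fin n))]
    {e : EuclideanSpace ℝ (Fin n)} {κ h : ℝ → ℝ}
    (hw : HasWeakGradient (Metric.ball 0 1) (dipole e κ) (∇ (dipole e κ)))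
    (hκ : ContDiff ℝ 2 κ) (hh : ContDiff ℝ 1 h) (hαh : ∀ τ < 0, α τ * κ τ = h τ)
    (heq : ∀ τ, (n - 1) * h τ = deriv (deriv κ) τ + n * deriv κ τ)
    (hV : IntegrableOn (dipoleField e (κ + h) (deriv κ - h)) (Metric.ball 0 1)) :
    IsWeakSolution (Metric.ball 0 1) (tangentialMedium α) (dipole e κ) := by
  have hκ' : ContDiff ℝ 1 (deriv κ) := (contDiff_succ_iff_deriv.1 hκ).2.2
  have hdiv : ∀ x ≠ 0, divergence (dipoleField e (κ + h) (deriv κ - h)) x = 0 := fun x hx =>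
    divergence_dipoleField_add_sub (hκ.differentiable two_ne_zero) (hκ'.differentiable one_ne_zero)
      (hh.differentiable one_ne_zero) (by simpa using heq) hx
  have hflux : ∀ x ∈ Metric.ball 0 1, x ≠ 0 → tangentialMedium α x *ᵥ (∇ (dipole e κ) x).ofLp =
      (dipoleField e (κ + h) (deriv κ - h) x).ofLp := fun x hx hx0 => by
    rw [gradient_dipole (hκ.differentiable two_ne_zero) hx0,
      tangentialMedium_mulVec_dipoleField hx0]
    simp only [dipoleField, Pi.add_apply, Pi.sub_apply, Pi.mul_apply, hαh _ (log_norm_neg hx0 hx)]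
  refine ⟨_, hw, fun φ hφ => ?_⟩
  rw [← setIntegral_inner_gradient_eq_zero_of_even (by simp) hV (dipoleField_neg e _ _)
    (fun x _ hx0 => contDiffAt_dipoleField ((hκ.of_le one_le_two).add hh) (hκ'.sub hh) hx0)
    (fun x _ hx0 => hdiv x hx0) hφ.1 hφ.2.1 hφ.2.2]
  refine integral_congr_ae ?_
  filter_upwards [ae_restrict_mem measurableSet_ball, ae_restrict_of_ae (Measure.ae_ne volume 0)]
    with x hx hx0
  rw [hflux x hx hx0, dotProduct_ofLp]

end TangentialMedium

section Profile

variable {d τ : ℝ}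

/-- The weight `1 / (64 + τ²)`: it is integrable on the line, and the constant `64` makes its
logarithmic derivatives small. -/
noncomputable def logWeight (τ : ℝ) : ℝ := (64 + τ ^ 2)⁻¹

/-- The radial profile, as a function of `τ = log ‖x‖`: the function `‖x‖ ^ (-d) - 1`, whose dipole
is harmonic in dimension `d` and vanishes on the unit sphere, times the logarithmic weight that
makes its gradient integrable at the origin. -/
noncomputable def profile (d τ : ℝ) : ℝ := (Real.exp (-(d * τ)) - 1) * logWeight τ

/-- The tangential excess `(κ'' + d κ') / (d - 1)` of the flux over the gradient, computed for
`κ = profile d`. -/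
noncomputable def fluxExcess (d τ : ℝ) : ℝ :=
  (2 * (d * τ) * logWeight τ ^ 2 * (Real.exp (-(d * τ)) + 1) +
    (8 * (τ ^ 2 * logWeight τ) - 2) * logWeight τ ^ 2 * (Real.exp (-(d * τ)) - 1)) / (d - 1)

/-- An envelope of `profile d` and its derivative on the negative half-line: in terms of `x` it is
`‖x‖ ^ (-d)` times the logarithmic weight, which is integrable at the origin in dimension `d`. -/
noncomputable def envelope (d τ : ℝ) : ℝ := (d + 1) * Real.exp (-(d * τ)) * logWeight τ

lemma logWeight_pos (τ : ℝ) : 0 < logWeight τ := by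
  rw [logWeight]
  positivity

lemma contDiff_logWeight {m : WithTop ℕ∞} : ContDiff ℝ m logWeight :=
  (contDiff_const.add (contDiff_id.pow 2)).inv fun τ => by positivity

lemma contDiff_profile {m : WithTop ℕ∞} (d : ℝ) : ContDiff ℝ m (profile d) := by
  have := contDiff_logWeight (m := m)
  unfold profile
  fun_prop

lemma contDiff_fluxExcess {m : WithTop ℕ∞} (d : ℝ) : ContDiff ℝ m (fluxExcess d) := by
  have := contDiff_logWeight (m := m)
  unfold fluxExcess
  fun_prop

lemma hasDerivAt_logWeight (τ : ℝ) : HasDerivAt logWeight (-2 * τ * logWeight τ ^ 2) τ := by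
  have hpos : 64 + τ ^ 2 ≠ 0 := by positivity
  refine (((hasDerivAt_pow 2 τ).const_add 64).fun_inv hpos).congr_deriv ?_
  rw [logWeight]
  field_simp
  ring

lemma hasDerivAt_exp_neg_mul (d τ : ℝ) :
    HasDerivAt (fun τ => Real.exp (-(d * τ))) (-d * Real.exp (-(d * τ))) τ := by
  refine ((hasDerivAt_id' τ).const_mul d).fun_neg.exp.congr_deriv ?_
  ring

lemma deriv_profile (d : ℝ) : deriv (profile d) = fun τ =>
    -d * Real.exp (-(d * τ)) * logWeight τ +
      (Real.exp (-(d * τ)) - 1) * (-2 * τ * logWeight τ ^ 2) :=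
  funext fun τ =>
    (((hasDerivAt_exp_neg_mul d τ).sub_const 1).fun_mul (hasDerivAt_logWeight τ)).deriv

lemma deriv_deriv_profile (d τ : ℝ) : deriv (deriv (profile d)) τ =
    d ^ 2 * Real.exp (-(d * τ)) * logWeight τ + 4 * d * τ * Real.exp (-(d * τ)) * logWeight τ ^ 2 +
      (Real.exp (-(d * τ)) - 1) * (8 * τ ^ 2 * logWeight τ ^ 3 - 2 * logWeight τ ^ 2) := by
  have hE := hasDerivAt_exp_neg_mul d τ
  have hw := hasDerivAt_logWeight τ
  rw [deriv_profile]
  refine (((hE.const_mul (-d)).fun_mul hw).fun_add ((hE.sub_const 1).fun_mul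
    (((hasDerivAt_id' τ).const_mul (-2)).fun_mul (hw.fun_pow 2)))).deriv.trans ?_
  norm_num
  ring

lemma sub_one_mul_fluxExcess (hd : d ≠ 1) (τ : ℝ) :
    (d - 1) * fluxExcess d τ = deriv (deriv (profile d)) τ + d * deriv (profile d) τ := by
  rw [fluxExcess, mul_div_cancel₀ _ (sub_ne_zero.2 hd), deriv_deriv_profile, deriv_profile]
  ring

lemma abs_mul_logWeight_le (τ : ℝ) : |τ| * logWeight τ ≤ 1 / 16 := by
  rw [logWeight, ← div_eq_mul_inv, div_le_iff₀ (by positivity), ← sq_abs τ]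
  nlinarith [sq_nonneg (|τ| - 8)]

lemma sq_mul_logWeight_le_one (τ : ℝ) : τ ^ 2 * logWeight τ ≤ 1 := by
  rw [logWeight, ← div_eq_mul_inv]
  exact div_le_one_of_le₀ (by linarith) (by positivity)

lemma logWeight_le (τ : ℝ) : logWeight τ ≤ 1 / 64 := by
  rw [logWeight, ← one_div]
  exact one_div_le_one_div_of_le (by norm_num) (by linarith [sq_nonneg τ])

lemma exp_neg_mul_sub_one_le (hd : 2 ≤ d) (τ : ℝ) :
    Real.exp (-(d * τ)) - 1 ≤ d / 2 * Real.exp (-(d * τ)) * (1 - Real.exp (2 * τ)) := by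
  have hbernoulli := one_add_mul_self_le_rpow_one_add (s := Real.exp (2 * τ) - 1) (p := d / 2)
    (by linarith [Real.exp_pos (2 * τ)]) (by linarith)
  rw [add_sub_cancel, ← Real.exp_mul, show 2 * τ * (d / 2) = d * τ by ring] at hbernoulli
  have hinv : Real.exp (-(d * τ)) * Real.exp (d * τ) = 1 := by rw [← Real.exp_add]; simp
  nlinarith [Real.exp_pos (-(d * τ))]

lemma profile_pos (hd : 0 < d) (hτ : τ < 0) : 0 < profile d τ :=
  mul_pos (sub_pos.2 (Real.one_lt_exp_iff.2 (neg_pos.2 (mul_neg_of_pos_of_neg hd hτ))))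
    (logWeight_pos τ)

lemma mul_abs_le_exp_neg_mul_sub_one (d : ℝ) (hτ : τ < 0) :
    d * |τ| ≤ Real.exp (-(d * τ)) - 1 := by
  rw [abs_of_neg hτ]
  linarith [Real.add_one_le_exp (-(d * τ))]

lemma abs_fluxExcess_le (hd : 2 ≤ d) (hτ : τ < 0) :
    |fluxExcess d τ| ≤ (10 + 4 * |τ|) * logWeight τ * profile d τ := by
  have hw := logWeight_pos τ
  have hq := mul_abs_le_exp_neg_mul_sub_one d hτ
  have hq0 : 0 ≤ Real.exp (-(d * τ)) - 1 := (by positivity : 0 ≤ d * |τ|).trans hq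
  -- `exp + 1 = (exp - 1) + 2`, and `hq` turns the leftover `2 * (d * |τ|)` into a multiple of
  -- `exp - 1`, so that the whole numerator is proportional to the profile.
  have hfirst : |2 * (d * τ) * logWeight τ ^ 2 * (Real.exp (-(d * τ)) + 1)| ≤
      (4 + 2 * (d * |τ|)) * (logWeight τ ^ 2 * (Real.exp (-(d * τ)) - 1)) := by
    have hE : 0 ≤ Real.exp (-(d * τ)) + 1 := by linarith
    simp only [abs_mul, abs_two, abs_pow, abs_of_pos hw, abs_of_nonneg hE,
      abs_of_nonneg (by linarith : 0 ≤ d)]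
    nlinarith [mul_le_mul_of_nonneg_left hq (sq_nonneg (logWeight τ))]
  have hsecond : |(8 * (τ ^ 2 * logWeight τ) - 2) * logWeight τ ^ 2 *
      (Real.exp (-(d * τ)) - 1)| ≤ 6 * (logWeight τ ^ 2 * (Real.exp (-(d * τ)) - 1)) := by
    rw [mul_assoc, abs_mul, abs_of_nonneg (mul_nonneg (sq_nonneg _) hq0)]
    gcongr
    have hsq : 0 ≤ τ ^ 2 * logWeight τ := by positivity
    exact abs_le.2 ⟨by linarith, by linarith [sq_mul_logWeight_le_one τ]⟩
  have hcoeff : 10 + 2 * (d * |τ|) ≤ (10 + 4 * |τ|) * (d - 1) := by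
    nlinarith [mul_nonneg (sub_nonneg.2 hd) (abs_nonneg τ)]
  rw [fluxExcess, abs_div, abs_of_pos (by linarith : 0 < d - 1), div_le_iff₀ (by linarith)]
  calc _ ≤ (10 + 2 * (d * |τ|)) * (logWeight τ ^ 2 * (Real.exp (-(d * τ)) - 1)) :=
        (abs_add_le _ _).trans ((add_le_add hfirst hsecond).trans_eq (by ring))
    _ ≤ (10 + 4 * |τ|) * (d - 1) * (logWeight τ ^ 2 * (Real.exp (-(d * τ)) - 1)) := by gcongr
    _ = (10 + 4 * |τ|) * logWeight τ * profile d τ * (d - 1) := by rw [profile]; ring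

lemma abs_profile_le (hd : 2 ≤ d) (hτ : τ < 0) :
    |profile d τ| ≤ envelope d τ * (1 - Real.exp (2 * τ)) := by
  have hexp : 0 ≤ 1 - Real.exp (2 * τ) := sub_nonneg.2 (Real.exp_le_one_iff.2 (by linarith))
  have hw := logWeight_pos τ
  rw [abs_of_pos (profile_pos (by linarith) hτ), profile, envelope, mul_right_comm]
  gcongr
  refine (exp_neg_mul_sub_one_le hd τ).trans ?_
  gcongr
  linarith

lemma abs_deriv_profile_le (hd : 2 ≤ d) (hτ : τ < 0) : |deriv (profile d) τ| ≤ envelope d τ := by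
  have hw := logWeight_pos τ
  have hE := Real.exp_pos (-(d * τ))
  have hq : |Real.exp (-(d * τ)) - 1| ≤ Real.exp (-(d * τ)) := by
    refine abs_le.2 ⟨?_, by linarith⟩
    linarith [(by positivity : 0 ≤ d * |τ|).trans (mul_abs_le_exp_neg_mul_sub_one d hτ)]
  have hτw : 2 * (|τ| * logWeight τ) ≤ 1 := by linarith [abs_mul_logWeight_le τ]
  have hd0 : |d| = d := abs_of_nonneg (by linarith)
  rw [deriv_profile]
  calc _ ≤ d * Real.exp (-(d * τ)) * logWeight τ +
        |Real.exp (-(d * τ)) - 1| * (2 * (|τ| * logWeight τ) * logWeight τ) := by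
        refine (abs_add_le _ _).trans_eq ?_
        simp only [abs_mul, abs_neg, abs_two, abs_pow, hd0, abs_of_pos hE, abs_of_pos hw]
        ring
    _ ≤ d * Real.exp (-(d * τ)) * logWeight τ + Real.exp (-(d * τ)) * (1 * logWeight τ) := by
        gcongr
    _ = envelope d τ := by rw [envelope]; ring

lemma integrable_logWeight : Integrable logWeight := by
  refine ((integrable_inv_one_add_sq.comp_div (R := 8) (by norm_num)).div_const 64).congr
    (.of_forall fun τ => ?_)
  rw [logWeight]
  field_simp
  ring

lemma integrable_exp_mul_envelope (d : ℝ) :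
    Integrable fun τ => Real.exp (d * τ) * envelope d τ := by
  refine (integrable_logWeight.const_mul (d + 1)).congr (.of_forall fun τ => ?_)
  simp only [envelope, Real.exp_neg]
  field_simp

end Profile

section TangentialExcess

variable {d τ : ℝ}

/-- The relative tangential excess `h / κ` of the flux over the gradient of the dipole with radial
profile `κ = profile d`. Since `profile d 0 = 0`, division by zero makes it vanish at `τ = 0`,
which is also the value of `log ‖x‖` at the origin. -/
noncomputable def tangentialExcess (d τ : ℝ) : ℝ := fluxExcess d τ / profile d τ

lemma tangentialExcess_zero (d : ℝ) : tangentialExcess d 0 = 0 := by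
  simp [tangentialExcess, profile]

lemma tangentialExcess_mul_profile (hd : 0 < d) (hτ : τ < 0) :
    tangentialExcess d τ * profile d τ = fluxExcess d τ :=
  div_mul_cancel₀ _ (profile_pos hd hτ).ne'

lemma continuousOn_tangentialExcess (hd : 0 < d) : ContinuousOn (tangentialExcess d) (Iio 0) :=
  (contDiff_fluxExcess (m := 0) d).continuous.continuousOn.div
    (contDiff_profile (m := 0) d).continuous.continuousOn fun _ hτ => (profile_pos hd hτ).ne'

lemma abs_tangentialExcess_le (hd : 2 ≤ d) (hτ : τ < 0) :
    |tangentialExcess d τ| ≤ (10 + 4 * |τ|) * logWeight τ := by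
  have hκ : 0 < profile d τ := profile_pos (by linarith) hτ
  rw [tangentialExcess, abs_div, abs_of_pos hκ, div_le_iff₀ hκ]
  exact abs_fluxExcess_le hd hτ

lemma abs_tangentialExcess_le_half (hd : 2 ≤ d) (hτ : τ < 0) : |tangentialExcess d τ| ≤ 1 / 2 := by
  linarith [abs_tangentialExcess_le hd hτ, logWeight_le τ, abs_mul_logWeight_le τ]

lemma tendsto_tangentialExcess_atBot (hd : 2 ≤ d) :
    Tendsto (tangentialExcess d) atBot (𝓝 0) := by
  have hinv : Tendsto (fun τ : ℝ => 5 * |τ|⁻¹) atBot (𝓝 0) := by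
    simpa using (tendsto_inv_atTop_zero.comp tendsto_abs_atBot_atTop).const_mul (5 : ℝ)
  refine squeeze_zero_norm' ?_ hinv
  filter_upwards [eventually_lt_atBot 0] with τ hτ
  refine (abs_tangentialExcess_le hd hτ).trans ?_
  rw [← div_eq_mul_inv, le_div_iff₀ (abs_pos.2 hτ.ne)]
  have hsq : |τ| ^ 2 * logWeight τ ≤ 1 := by simpa only [sq_abs] using sq_mul_logWeight_le_one τ
  linarith [abs_mul_logWeight_le τ]

lemma abs_fluxExcess_le_abs_profile (hd : 2 ≤ d) (hτ : τ < 0) :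
    |fluxExcess d τ| ≤ |profile d τ| := by
  rw [← tangentialExcess_mul_profile (by linarith) hτ, abs_mul]
  exact mul_le_of_le_one_left (abs_nonneg _)
    ((abs_tangentialExcess_le_half hd hτ).trans (by norm_num))

end TangentialExcess

section Solution

variable {n : ℕ} [Nontrivial (EuclideanSpace ℝ (Fin n))]

lemma integrableOn_dipoleField_profile (hn : 2 ≤ n) (e : EuclideanSpace ℝ (Fin n)) :
    IntegrableOn (dipoleField e (profile n + fluxExcess n) (deriv (profile n) - fluxExcess n))
      (Metric.ball 0 1) := by
  have hd : (2 : ℝ) ≤ n := by exact_mod_cast hn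
  have hκ : ContDiff ℝ 1 (profile n) := contDiff_profile n
  have hh : Continuous (fluxExcess n) := (contDiff_fluxExcess (m := 0) n).continuous
  have hm : Integrable fun τ => Real.exp (n * τ) * (2 * envelope n τ) := by
    simpa only [mul_left_comm] using (integrable_exp_mul_envelope n).const_mul 2
  have hκm : ∀ τ < 0, |profile n τ| ≤ envelope n τ := fun τ hτ =>
    (abs_profile_le hd hτ).trans (mul_le_of_le_one_right
      ((abs_nonneg _).trans (abs_deriv_profile_le hd hτ)) (by linarith [Real.exp_pos (2 * τ)]))
  refine integrableOn_dipoleField (by simpa using hm) (hκ.continuous.add hh).measurable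
    ((hκ.continuous_deriv_one).sub hh).measurable (fun τ hτ => ?_) (fun τ hτ => ?_)
  · refine (abs_add_le _ _).trans ?_
    linarith [abs_fluxExcess_le_abs_profile hd hτ, hκm τ hτ]
  · refine (abs_sub _ _).trans ?_
    linarith [abs_fluxExcess_le_abs_profile hd hτ, hκm τ hτ, abs_deriv_profile_le hd hτ]

lemma hasWeakGradient_and_memW11Zero_dipole_profile (hn : 2 ≤ n)
    (e : EuclideanSpace ℝ (Fin n)) :
    HasWeakGradient (Metric.ball 0 1) (dipole e (profile n)) (∇ (dipole e (profile n))) ∧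
      MemW11Zero (Metric.ball 0 1) (dipole e (profile n)) :=
  have hd : (2 : ℝ) ≤ n := by exact_mod_cast hn
  hasWeakGradient_and_memW11Zero_dipole (contDiff_profile n) (integrable_exp_mul_envelope n)
    (fun _ => abs_profile_le hd) (fun _ => abs_deriv_profile_le hd)

lemma isWeakSolution_dipole_profile (hn : 2 ≤ n) (e : EuclideanSpace ℝ (Fin n)) :
    IsWeakSolution (Metric.ball 0 1) (tangentialMedium (tangentialExcess n))
      (dipole e (profile n)) :=
  isWeakSolution_dipole (hasWeakGradient_and_memW11Zero_dipole_profile hn e).1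
    (contDiff_profile n) (contDiff_fluxExcess n)
    (fun _ => tangentialExcess_mul_profile (by positivity))
    (sub_one_mul_fluxExcess (by exact_mod_cast (by omega : n ≠ 1)))
    (integrableOn_dipoleField_profile hn e)

end Solution

theorem proposition2 (n : ℕ) (hn : 2 ≤ n) :
    ∃ A : EuclideanSpace ℝ (Fin n) → Matrix (Fin n) (Fin n) ℝ,
      ContinuousOn A (Metric.ball 0 1) ∧ IsElliptic (Metric.ball 0 1) A ∧
      ∃ u : EuclideanSpace ℝ (Fin n) → ℝ,
        MemW11Zero (Metric.ball 0 1) u ∧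
        IsWeakSolution (Metric.ball 0 1) A u ∧
        ¬ (∀ᵐ x ∂(volume.restrict (Metric.ball (0 : EuclideanSpace ℝ (Fin n)) 1)), u x = 0) := by
  have hd : (2 : ℝ) ≤ n := by exact_mod_cast hn
  have : Nonempty (Fin n) := ⟨⟨0, by omega⟩⟩
  obtain ⟨e, he⟩ := exists_ne (0 : EuclideanSpace ℝ (Fin n))
  refine ⟨tangentialMedium (tangentialExcess n), ?_, ?_, dipole e (profile n),
    (hasWeakGradient_and_memW11Zero_dipole_profile hn e).2, isWeakSolution_dipole_profile hn e, ?_⟩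
  · exact continuousOn_tangentialMedium (continuousOn_tangentialExcess (by linarith))
      (tangentialExcess_zero n) (tendsto_tangentialExcess_atBot hd)
  · refine isElliptic_tangentialMedium (one_half_lt_one (α := ℝ)) fun x hx => ?_
    rcases eq_or_ne x 0 with rfl | hx0
    · simp [tangentialExcess_zero]
    · exact abs_tangentialExcess_le_half hd (log_norm_neg hx0 hx)
  · exact not_ae_dipole_eq_zero volume he (contDiff_profile (m := 0) n).continuous
      ⟨-1, neg_one_lt_zero, (profile_pos (by linarith) neg_one_lt_zero).ne'⟩
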